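/- Write permutations in one-line notation. A permutation $\pi=\pi_1\cdots\pi_n$ of $\{1,\dots,n\}$ is a \emph{Fishburn permutation} if there are no indices $j,k$ with $j+1<k$, $\pi_j=\pi_k+1$ and $\pi_{j+1}>\pi_j$. A permutation contains a pattern $\sigma$ if it has a subsequence of the same length and relative order as $\sigma$, and avoids $\sigma$ otherwise. Let $F_n(321,2143)$ be the set of Fishburn permutations of length $n$ which avoid both $321$ and $2143$, and let $\mathrm{ltormax}(\pi)$ be the number of left-to-right maxima of $\pi$, that is, of entries of $\pi$ which are greater than all entries to their left. Then for all $n\ge 1$ the following hold. 1. As polynomials in $t$, $$\sum_{\pi\in F_n(321,2143)} t^{\mathrm{ltormax}(\pi)} = t(t+1)^{n-1}.$$ 2. For all $k\ge 1$, the number of permutations in $F_n(321,2143)$ with exactly $k$ left-to-right maxima is $\binom{n-1}{k-1}$. 3. $|F_n(321,2143)| = 2^{n-1}$. -/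

import Mathlib

namespace PatternAvoidance

/-- The sequence `α` contains the sequence `β`: some subsequence of `α` has the same length and
the same relative order as `β`. -/
def Contains {A B : Type*} [LinearOrder A] [LinearOrder B] {n k : ℕ}
    (α : Fin n → A) (β : Fin k → B) : Prop :=
  ∃ e : Fin k → Fin n, StrictMono e ∧ ∀ i j : Fin k, α (e i) < α (e j) ↔ β i < β j

/-- A permutation `π` (with one-line notation `π 0, π 1, …, π (n - 1)`, values shifted to
`0, …, n - 1`) is a Fishburn permutation if there are no positions `j`, `j' = j + 1` and `k` with
`j + 1 < k`, `π j = π k + 1` and `π (j + 1) > π j`. -/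
def IsFishburn {n : ℕ} (π : Equiv.Perm (Fin n)) : Prop :=
  ¬ ∃ j j' k : Fin n, (j' : ℕ) = j + 1 ∧ j' < k ∧ (π j : ℕ) = π k + 1 ∧ π j < π j'

/-- The left-to-right maxima of `π`, recorded by their positions: `i` is such a position if `π i`
is greater than all the entries to its left. -/
def ltorMaxima {n : ℕ} (π : Equiv.Perm (Fin n)) : Finset (Fin n) :=
  Finset.univ.filter fun i => ∀ j : Fin n, j < i → π j < π i

/-- The number of left-to-right maxima of `π`. -/
def ltormax {n : ℕ} (π : Equiv.Perm (Fin n)) : ℕ := (ltorMaxima π).card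

open Classical in
/-- `F_n(321, 2143)`: the Fishburn permutations of length `n` which avoid `321` and `2143`. -/
noncomputable def fishburn321_2143 (n : ℕ) : Finset (Equiv.Perm (Fin n)) :=
  Finset.univ.filter fun π =>
    IsFishburn π ∧ ¬ Contains π ![3, 2, 1] ∧ ¬ Contains π ![2, 1, 4, 3]

end PatternAvoidance

namespace PatternAvoidance

open Finset

variable {n : ℕ}

/-! A permutation in the class is determined by the set `S` of positions of its left-to-right
maxima, and every `S` containing the first position occurs (`bijOn_ltorMaxima`). Let `q` be the
first non-maximum and `p = q - 1`. The Fishburn condition makes the entries before `p` smaller than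
everything after them, avoiding 321 makes the non-maxima increase, and avoiding 2143 puts them all
below `π p`. So the values increase along the positions before `p`, then the non-maxima, then the
other maxima: this is the order of `blockKey S`. If there is no non-maximum, all positions have
block `0` and `π` is the identity. Conversely, sorting by `blockKey S` gives a member of the class.
The binomial theorem then sums `t ^ |S|`. -/

/-- For a set `S` of positions, `block S i` is `0` if `i` lies strictly before the last position
of the initial segment contained in `S`, `1` if `i ∉ S`, and `2` for the other elements of `S`. -/
def block (S : Finset (Fin n)) (i : Fin n) : ℕ :=
  if ∀ j : Fin n, (j : ℕ) ≤ i + 1 → j ∈ S then 0 else if i ∈ S then 2 else 1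

/-- Sorting positions by `blockKey S` means sorting by block, and by position in each block. -/
def blockKey (S : Finset (Fin n)) (i : Fin n) : ℕ ×ₗ Fin n := toLex (block S i, i)

lemma blockKey_lt {S : Finset (Fin n)} {i j : Fin n} :
    blockKey S i < blockKey S j ↔ block S i < block S j ∨ block S i = block S j ∧ i < j :=
  Prod.Lex.toLex_lt_toLex

lemma blockKey_injective (S : Finset (Fin n)) : Function.Injective (blockKey S) := by
  intro i j h
  exact (Prod.ext_iff.1 (toLex.injective h)).2

lemma block_eq_zero {S : Finset (Fin n)} {i : Fin n} :
    block S i = 0 ↔ ∀ j : Fin n, (j : ℕ) ≤ i + 1 → j ∈ S := by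
  unfold block; split_ifs <;> simp_all

lemma block_eq_one {S : Finset (Fin n)} {i : Fin n} : block S i = 1 ↔ i ∉ S := by
  unfold block
  split_ifs with h h'
  · simpa using h i (by omega)
  · simpa using h'
  · simpa using h'

lemma block_eq_two {S : Finset (Fin n)} {i : Fin n} :
    block S i = 2 ↔ i ∈ S ∧ ∃ j : Fin n, (j : ℕ) ≤ i + 1 ∧ j ∉ S := by
  unfold block
  split_ifs with h h'
  · simpa using fun _ => h
  · simpa [h'] using h
  · simp [h']

lemma block_le_two (S : Finset (Fin n)) (i : Fin n) : block S i ≤ 2 := by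
  unfold block; split_ifs <;> simp

lemma block_eq_zero_of_le {S : Finset (Fin n)} {i j : Fin n} (hij : i ≤ j)
    (hj : block S j = 0) : block S i = 0 := by
  rw [block_eq_zero] at *
  intro k hk
  exact hj k (by have : (i : ℕ) ≤ j := hij; omega)

/-- A nonempty complement has a least element, and its predecessor lies in block `2`. -/
lemma exists_consecutive_mem_not_mem {m : ℕ} {S : Finset (Fin (m + 1))} (h0 : 0 ∈ S)
    {i : Fin (m + 1)} (hi : i ∉ S) :
    ∃ p q : Fin (m + 1), (q : ℕ) = p + 1 ∧ p ∈ S ∧ q ∉ S ∧ ∀ j, j ∉ S → q ≤ j := by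
  obtain ⟨q, hq, hmin⟩ := (univ.filter (· ∉ S)).exists_minimal ⟨i, by simpa using hi⟩
  simp only [mem_filter, mem_univ, true_and] at hq hmin
  have hle : ∀ j, j ∉ S → q ≤ j := fun j hj => (le_total q j).elim id (hmin hj)
  have hq0 : (q : ℕ) ≠ 0 := fun h => hq (by rwa [show q = 0 from Fin.ext h])
  refine ⟨⟨q - 1, by omega⟩, q, by simp; omega, ?_, hq, hle⟩
  by_contra hp
  have : (q : ℕ) ≤ q - 1 := hle _ hp
  omega

/-- Every injective map to a linear order is standardized by a permutation. -/
lemma exists_perm_lt_iff {α : Type*} [LinearOrder α] {f : Fin n → α}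
    (hf : Function.Injective f) : ∃ π : Equiv.Perm (Fin n), ∀ i j, π i < π j ↔ f i < f j := by
  refine ⟨(Tuple.sort f)⁻¹, fun i j => ?_⟩
  have hs : StrictMono (f ∘ Tuple.sort f) :=
    (Tuple.monotone_sort f).strictMono_of_injective (hf.comp (Tuple.sort f).injective)
  have := hs.lt_iff_lt (a := (Tuple.sort f)⁻¹ i) (b := (Tuple.sort f)⁻¹ j)
  simpa using this.symm

lemma perm_eq_of_lt_iff {π σ : Equiv.Perm (Fin n)} (h : ∀ i j, π i < π j ↔ σ i < σ j) :
    π = σ := by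
  have e : (⟨π.symm.trans σ, by
      intro a b
      have := h (π.symm b) (π.symm a)
      simpa using not_congr this.symm⟩ : Fin n ≃o Fin n) = OrderIso.refl _ :=
    Subsingleton.elim _ _
  ext i
  have := congrArg (fun f : Fin n ≃o Fin n => f (π i)) e
  simp at this
  exact congrArg Fin.val this.symm

lemma contains_321_iff {π : Equiv.Perm (Fin n)} :
    Contains π ![3, 2, 1] ↔ ∃ a b c, a < b ∧ b < c ∧ π c < π b ∧ π b < π a := by
  constructor
  · rintro ⟨e, he, h⟩
    exact ⟨e 0, e 1, e 2, he (by decide), he (by decide), (h 2 1).2 (by simp),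
      (h 1 0).2 (by simp)⟩
  · rintro ⟨a, b, c, hab, hbc, h1, h2⟩
    refine ⟨![a, b, c], ?_, ?_⟩
    · rw [Fin.strictMono_iff_lt_succ]
      intro i
      fin_cases i <;> simpa
    · intro i j
      fin_cases i <;> fin_cases j <;> simp <;> order

lemma contains_2143_iff {π : Equiv.Perm (Fin n)} :
    Contains π ![2, 1, 4, 3] ↔
      ∃ a b c d, a < b ∧ b < c ∧ c < d ∧ π b < π a ∧ π a < π d ∧ π d < π c := by
  constructor
  · rintro ⟨e, he, h⟩
    exact ⟨e 0, e 1, e 2, e 3, he (by decide), he (by decide), he (by decide),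
      (h 1 0).2 (by simp), (h 0 3).2 (by simp), (h 3 2).2 (by simp)⟩
  · rintro ⟨a, b, c, d, hab, hbc, hcd, h1, h2, h3⟩
    refine ⟨![a, b, c, d], ?_, ?_⟩
    · rw [Fin.strictMono_iff_lt_succ]
      intro i
      fin_cases i <;> simpa
    · intro i j
      fin_cases i <;> fin_cases j <;> simp <;> order

lemma mem_ltorMaxima {π : Equiv.Perm (Fin n)} {i : Fin n} :
    i ∈ ltorMaxima π ↔ ∀ j, j < i → π j < π i := by
  simp [ltorMaxima]

lemma not_mem_ltorMaxima {π : Equiv.Perm (Fin n)} {i : Fin n} :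
    i ∉ ltorMaxima π ↔ ∃ j, j < i ∧ π i < π j := by
  rw [mem_ltorMaxima]
  push Not
  refine exists_congr fun j => and_congr_right fun h => ?_
  exact ⟨fun h' => h'.lt_of_ne fun e => h.ne' (π.injective e), le_of_lt⟩

/-! ### Uniqueness: the maxima determine the permutation. -/

/-- In a Fishburn permutation, an entry of block `0` is smaller than everything after it. -/
lemma IsFishburn.lt_of_block_eq_zero {π : Equiv.Perm (Fin n)} (hF : IsFishburn π)
    (i : Fin n) (hi : block (ltorMaxima π) i = 0) {k : Fin n} (hk : i < k) : π i < π k := by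
  by_contra hlt
  have hki : π k < π i := lt_of_le_of_ne (not_lt.1 hlt) fun e => hk.ne' (π.injective e)
  have hki' : (π k : ℕ) < π i := hki
  have hk' : (i : ℕ) < k := hk
  -- `l` carries the value just below `π i`. As `i, i + 1` is an ascent, the Fishburn condition
  -- forces `l < i`; induction at `l` then gives `π l < π k < π l + 1`.
  obtain ⟨l, hl⟩ := π.surjective ⟨π i - 1, by omega⟩
  have hl' : (π i : ℕ) = π l + 1 := by rw [hl]; simp; omega
  let i' : Fin n := ⟨i + 1, by omega⟩
  have hi' : π i < π i' :=
    mem_ltorMaxima.1 (block_eq_zero.1 hi i' (by simp [i'])) i (Fin.lt_def.2 (by simp [i']))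
  have hli : l < i := by
    rcases lt_trichotomy l i' with h | h | h
    · have h1 : (l : ℕ) < i + 1 := h
      refine lt_of_le_of_ne (Fin.le_def.2 (by omega)) ?_
      rintro rfl
      omega
    · have : (π i : ℕ) < π i' := hi'
      rw [← h] at this
      omega
    · exact (hF ⟨i, i', l, rfl, h, hl', hi'⟩).elim
  have hlk := IsFishburn.lt_of_block_eq_zero hF l (block_eq_zero_of_le hli.le hi) (hli.trans hk)
  have : (π l : ℕ) < π k := hlk
  omega
termination_by (i : ℕ)

/-- The left-to-right maxima of a permutation in the class determine the order of its entries. -/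
lemma lt_of_blockKey_lt {m : ℕ} {π : Equiv.Perm (Fin (m + 1))} (hF : IsFishburn π)
    (h3 : ¬ Contains π ![3, 2, 1]) (h4 : ¬ Contains π ![2, 1, 4, 3]) {i j : Fin (m + 1)}
    (h : blockKey (ltorMaxima π) i < blockKey (ltorMaxima π) j) : π i < π j := by
  have h0 : (0 : Fin (m + 1)) ∈ ltorMaxima π := mem_ltorMaxima.2 fun j hj => by simp at hj
  rw [contains_321_iff] at h3
  rw [contains_2143_iff] at h4
  have hj2 := block_le_two (ltorMaxima π) j
  by_cases hj : j ∈ ltorMaxima π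
  · by_cases hij : i < j
    · exact mem_ltorMaxima.1 hj i hij
    rw [blockKey_lt] at h
    have hlt : block (ltorMaxima π) i < block (ltorMaxima π) j := by tauto
    have hi0 : block (ltorMaxima π) i ≠ 0 := fun h0 => by
      have := block_eq_zero_of_le (not_lt.1 hij) h0
      omega
    have hi1 : i ∉ ltorMaxima π := block_eq_one.1 (by omega)
    obtain ⟨-, k, hkj, hk⟩ := block_eq_two.1 (show block (ltorMaxima π) j = 2 by omega)
    -- `p` is the first position of block `2`, so it suffices to show `π i < π p`.
    obtain ⟨p, q, hqp, hp, hq, hmin⟩ := exists_consecutive_mem_not_mem h0 hi1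
    have hpj : p ≤ j := by
      have : (q : ℕ) ≤ k := hmin k hk
      exact Fin.le_def.2 (by omega)
    have hpj' : π p ≤ π j := by
      rcases hpj.eq_or_lt with rfl | h
      · exact le_rfl
      · exact (mem_ltorMaxima.1 hj p h).le
    have hple : ∀ a ≤ p, π a ≤ π p := by
      intro a ha
      rcases ha.eq_or_lt with rfl | h
      · exact le_rfl
      · exact (mem_ltorMaxima.1 hp a h).le
    have hpq : p < q := Fin.lt_def.2 (by omega)
    have hlep : ∀ a, a < q → a ≤ p := fun a ha => by
      have : (a : ℕ) < q := ha
      exact Fin.le_def.2 (by omega)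
    have hqp' : π q < π p := by
      obtain ⟨a, ha, ha'⟩ := not_mem_ltorMaxima.1 hq
      exact ha'.trans_le (hple a (hlep a ha))
    refine lt_of_lt_of_le ?_ hpj'
    by_contra hle
    rw [not_lt] at hle
    have hpi : π p < π i := hle.lt_of_ne fun e => hi1 (π.injective e ▸ hp)
    -- Entries up to position `q` are at most `π p`, so a larger entry `a` before `i` lies after
    -- `q`, and `p, q, a, i` form 2143.
    obtain ⟨a, hai, ha⟩ := not_mem_ltorMaxima.1 hi1
    have hqa : q < a := by
      by_contra hqa
      rcases (not_lt.1 hqa).eq_or_lt with rfl | h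
      · exact absurd (hpi.trans ha) hqp'.not_gt
      · exact absurd (hpi.trans ha) (hple a (hlep a h)).not_gt
    exact h4 ⟨p, q, a, i, hpq, hqa, hai, hqp', hpi, ha⟩
  · have hj1 := block_eq_one.2 hj
    rw [blockKey_lt, hj1] at h
    rcases h with h | ⟨h, hij⟩
    · refine hF.lt_of_block_eq_zero i (by omega) ?_
      by_contra hle
      have := block_eq_zero_of_le (not_lt.1 hle) (show block (ltorMaxima π) i = 0 by omega)
      omega
    · obtain ⟨a, ha, ha'⟩ := not_mem_ltorMaxima.1 (block_eq_one.1 h)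
      by_contra hle
      have hji : π j < π i := (not_lt.1 hle).lt_of_ne fun e => hij.ne' (π.injective e)
      exact h3 ⟨a, i, j, ha, hij, hji, ha'⟩

lemma lt_iff_blockKey_lt {m : ℕ} {π : Equiv.Perm (Fin (m + 1))} (hF : IsFishburn π)
    (h3 : ¬ Contains π ![3, 2, 1]) (h4 : ¬ Contains π ![2, 1, 4, 3]) (i j : Fin (m + 1)) :
    π i < π j ↔ blockKey (ltorMaxima π) i < blockKey (ltorMaxima π) j := by
  refine ⟨fun h => ?_, lt_of_blockKey_lt hF h3 h4⟩
  rcases lt_trichotomy (blockKey (ltorMaxima π) i) (blockKey (ltorMaxima π) j) with h' | h' | h'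
  · exact h'
  · exact absurd h (blockKey_injective _ h' ▸ lt_irrefl _)
  · exact absurd h (lt_of_blockKey_lt hF h3 h4 h').not_gt

/-! ### Existence: sorting by `blockKey S` gives a member of the class. -/

/-- Values increase within a block, so inversions occur only between blocks. -/
lemma block_lt_of_gt {S : Finset (Fin n)} {π : Equiv.Perm (Fin n)}
    (h : ∀ i j, π i < π j ↔ blockKey S i < blockKey S j) {i j : Fin n} (hij : i < j)
    (hπ : π j < π i) : block S j < block S i := by
  rw [h, blockKey_lt] at hπ
  exact hπ.resolve_right fun h' => hij.not_gt h'.2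

lemma block_le_of_lt {S : Finset (Fin n)} {π : Equiv.Perm (Fin n)}
    (h : ∀ i j, π i < π j ↔ blockKey S i < blockKey S j) {i j : Fin n}
    (hπ : π i < π j) : block S i ≤ block S j := by
  rw [h, blockKey_lt] at hπ
  exact hπ.elim le_of_lt fun h' => h'.1.le

lemma ltorMaxima_eq_of_lt_iff {m : ℕ} {S : Finset (Fin (m + 1))} (h0 : 0 ∈ S)
    {π : Equiv.Perm (Fin (m + 1))} (h : ∀ i j, π i < π j ↔ blockKey S i < blockKey S j) :
    ltorMaxima π = S := by
  ext i
  constructor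
  · intro hi
    by_contra hiS
    obtain ⟨p, q, hqp, hp, hq, hmin⟩ := exists_consecutive_mem_not_mem h0 hiS
    have hqi : (q : ℕ) ≤ i := hmin i hiS
    have hpi : p < i := Fin.lt_def.2 (by omega)
    have hb := block_le_of_lt h (mem_ltorMaxima.1 hi p hpi)
    rw [block_eq_one.2 hiS, block_eq_two.2 ⟨hp, q, by omega, hq⟩] at hb
    omega
  · intro hi
    refine mem_ltorMaxima.2 fun j hj => ?_
    rw [h, blockKey_lt]
    have hi1 : block S i ≠ 1 := fun h => block_eq_one.1 h hi
    have hi2 := block_le_two S i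
    have hj2 := block_le_two S j
    have h0 : block S i = 0 → block S j = 0 := block_eq_zero_of_le hj.le
    simp only [hj, and_true]
    omega

lemma isFishburn_of_lt_iff {m : ℕ} {S : Finset (Fin (m + 1))} (h0 : 0 ∈ S)
    {π : Equiv.Perm (Fin (m + 1))} (h : ∀ i j, π i < π j ↔ blockKey S i < blockKey S j) :
    IsFishburn π := by
  rintro ⟨j, j', k, hjj, hjk, hval, hlt⟩
  have hjj' : j < j' := Fin.lt_def.2 (by omega)
  have hkj := block_lt_of_gt h (hjj'.trans hjk) (Fin.lt_def.2 (by omega))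
  have hle := block_le_of_lt h hlt
  have hk0 : block S k ≠ 0 := fun h0 => by
    have := block_eq_zero_of_le (hjj'.trans hjk).le h0
    omega
  have hj2 := block_le_two S j
  have hj'2 := block_le_two S j'
  obtain ⟨hj, l, hl, hlS⟩ := block_eq_two.1 (show block S j = 2 by omega)
  obtain ⟨hj', -⟩ := block_eq_two.1 (show block S j' = 2 by omega)
  obtain ⟨p, q, hqp, hp, hq, hmin⟩ := exists_consecutive_mem_not_mem h0 hlS
  have hql : (q : ℕ) ≤ l := hmin l hlS
  have hlj' : (l : ℕ) ≠ j' := fun e => hlS (Fin.ext e ▸ hj')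
  have hpj : p < j := Fin.lt_def.2 (by omega)
  -- The value `π p` lies strictly between `π k` (block `1`) and `π j` (block `2`), so these cannot
  -- be consecutive.
  have hp2 : block S p = 2 := block_eq_two.2 ⟨hp, q, by omega, hq⟩
  have h1 : π p < π j := (h _ _).2 (blockKey_lt.2 (Or.inr ⟨by omega, hpj⟩))
  have h2 : π k < π p := (h _ _).2 (blockKey_lt.2 (Or.inl (by omega)))
  have h1' : (π p : ℕ) < π j := h1
  have h2' : (π k : ℕ) < π p := h2
  omega

/-- The entries would need blocks `2`, `1`, `0` in turn, but every position left of block `0` is in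
block `0`. -/
lemma not_contains_321_of_lt_iff {S : Finset (Fin n)} {π : Equiv.Perm (Fin n)}
    (h : ∀ i j, π i < π j ↔ blockKey S i < blockKey S j) : ¬ Contains π ![3, 2, 1] := by
  rw [contains_321_iff]
  rintro ⟨a, b, c, hab, hbc, h1, h2⟩
  have := block_lt_of_gt h hab h2
  have := block_lt_of_gt h hbc h1
  have := block_le_two S a
  have := block_eq_zero_of_le hbc.le (show block S c = 0 by omega)
  omega

lemma not_contains_2143_of_lt_iff {S : Finset (Fin n)} {π : Equiv.Perm (Fin n)}
    (h : ∀ i j, π i < π j ↔ blockKey S i < blockKey S j) : ¬ Contains π ![2, 1, 4, 3] := by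
  rw [contains_2143_iff]
  rintro ⟨a, b, c, d, hab, hbc, hcd, h1, h2, h3⟩
  have := block_lt_of_gt h hab h1
  have := block_lt_of_gt h hcd h3
  have := block_le_of_lt h h2
  have := block_le_two S c
  -- The blocks satisfy `b < a ≤ d < c ≤ 2`, so `b` is in block `0`, and hence so is `a`.
  have := block_eq_zero_of_le hab.le (show block S b = 0 by omega)
  omega

/-- Taking left-to-right maxima is a bijection from `F_{m+1}(321, 2143)` to the sets of positions
that contain the first one. -/
lemma bijOn_ltorMaxima (m : ℕ) :
    Set.BijOn ltorMaxima (fishburn321_2143 (m + 1) : Set (Equiv.Perm (Fin (m + 1))))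
      {S | 0 ∈ S} := by
  refine ⟨fun π _ => mem_ltorMaxima.2 fun j hj => by simp at hj, ?_, ?_⟩
  · intro π hπ σ hσ e
    simp only [fishburn321_2143, coe_filter, mem_univ, true_and, Set.mem_ofPred_eq] at hπ hσ
    refine perm_eq_of_lt_iff fun i j => ?_
    rw [lt_iff_blockKey_lt hπ.1 hπ.2.1 hπ.2.2, lt_iff_blockKey_lt hσ.1 hσ.2.1 hσ.2.2, e]
  · intro S hS
    obtain ⟨π, h⟩ := exists_perm_lt_iff (blockKey_injective S)
    refine ⟨π, ?_, ltorMaxima_eq_of_lt_iff hS h⟩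
    simp only [fishburn321_2143, coe_filter, mem_univ, true_and, Set.mem_ofPred_eq]
    exact ⟨isFishburn_of_lt_iff hS h, not_contains_321_of_lt_iff h,
      not_contains_2143_of_lt_iff h⟩

/-! ### The generating function. -/

/-- Erasing `0` leaves an arbitrary subset of the other `m` positions. -/
lemma sum_pow_card_of_zero_mem {R : Type*} [CommSemiring R] (m : ℕ) (x : R) :
    ∑ S ∈ univ.filter (fun S : Finset (Fin (m + 1)) => 0 ∈ S), x ^ S.card =
      x * (x + 1) ^ m := by
  have hs := Finset.sum_pow_mul_eq_add_pow x 1 (univ.erase (0 : Fin (m + 1)))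
  simp only [one_pow, mul_one, card_erase_of_mem (mem_univ _), card_univ, Fintype.card_fin,
    Nat.add_sub_cancel] at hs
  rw [← hs, mul_sum]
  refine sum_bij' (fun S _ => S.erase 0) (fun S _ => insert 0 S) ?_ ?_ ?_ ?_ ?_
  · exact fun S _ => mem_powerset.2 (erase_subset_erase _ (subset_univ _))
  · simp
  · intro S hS
    exact insert_erase (mem_filter.1 hS).2
  · intro S hS
    exact erase_insert fun h => by simpa using mem_powerset.1 hS h
  · intro S hS
    rw [← card_erase_add_one (mem_filter.1 hS).2, pow_succ']

theorem sum_pow_ltormax (m : ℕ) :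
    ∑ π ∈ fishburn321_2143 (m + 1), (Polynomial.X : Polynomial ℕ) ^ ltormax π =
      Polynomial.X * (Polynomial.X + 1) ^ m := by
  rw [← sum_pow_card_of_zero_mem]
  obtain ⟨hm, hi, hs⟩ := bijOn_ltorMaxima m
  refine sum_bij (fun π _ => ltorMaxima π) ?_ ?_ ?_ fun _ _ => rfl
  · exact fun π hπ => mem_filter.2 ⟨mem_univ _, hm hπ⟩
  · exact fun π hπ σ hσ e => hi hπ hσ e
  · intro S hS
    obtain ⟨π, hπ, e⟩ := hs (mem_filter.1 hS).2
    exact ⟨π, hπ, e⟩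

end PatternAvoidance

theorem mainTheorem9 (n : ℕ) (hn : 1 ≤ n) :
    (∑ π ∈ PatternAvoidance.fishburn321_2143 n,
        (Polynomial.X : Polynomial ℕ) ^ PatternAvoidance.ltormax π =
      Polynomial.X * (Polynomial.X + 1) ^ (n - 1)) ∧
    (∀ k : ℕ, 1 ≤ k →
      ((PatternAvoidance.fishburn321_2143 n).filter
        fun π => PatternAvoidance.ltormax π = k).card = (n - 1).choose (k - 1)) ∧
    (PatternAvoidance.fishburn321_2143 n).card = 2 ^ (n - 1) := by
  obtain ⟨m, rfl⟩ := Nat.exists_eq_add_of_le' hn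
  have h := PatternAvoidance.sum_pow_ltormax m
  refine ⟨h, fun k hk => ?_, ?_⟩
  · obtain ⟨k, rfl⟩ := Nat.exists_eq_add_of_le' hk
    have hc := congrArg (fun p => Polynomial.coeff p (k + 1)) h
    simp only [Polynomial.finsetSum_coeff, Polynomial.coeff_X_pow, Polynomial.coeff_X_mul,
      Polynomial.coeff_X_add_one_pow, Finset.sum_boole, Nat.cast_id] at hc
    simpa [eq_comm] using hc
  · have he := congrArg (Polynomial.eval 1) h
    simpa [Polynomial.eval_finsetSum, one_add_one_eq_two] using he
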